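/- Let $R$ be a commutative Noetherian ring with identity and let $\mathfrak a$ be a proper ideal of $R$. For an $R$-module $M$ and $i\ge 0$ let $H^i_{\mathfrak a}(M)=\varinjlim_n \operatorname{Ext}^i_R(R/\mathfrak a^n,M)$, and let $\operatorname{cd}(\mathfrak a,M)$ be the largest integer $i$ with $H^i_{\mathfrak a}(M)\neq 0$. A finitely generated $R$-module $M$ is called $\mathfrak a$-relative regular if either $M=\mathfrak a M$, or $M\neq\mathfrak a M$ and $\mathfrak a$ can be generated by an $M$-regular sequence of length $\operatorname{cd}(\mathfrak a,R)$ which is also an $R$-regular sequence. Let $\mathscr R_{\mathfrak a}(R)$ be the full subcategory of $\mathfrak a$-relative regular $R$-modules. A finitely generated $R$-module $C$ is called semidualizing if the homothety map $R\to\operatorname{Hom}_R(C,C)$ is an isomorphism and $\operatorname{Ext}^i_R(C,C)=0$ for all $i>0$. The Auslander class $\mathscr A_C(R)$ consists of all $R$-modules $M$ for which the natural map $M\to\operatorname{Hom}_R(C,C\otimes_R M)$ is an isomorphism and $\operatorname{Tor}^R_i(C,M)=0=\operatorname{Ext}^i_R(C,C\otimes_R M)$ for all $i\ge1$. The Bass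 class $\mathscr B_C(R)$ consists of all $R$-modules $M$ for which the evaluation map $C\otimes_R\operatorname{Hom}_R(C,M)\to M$ is an isomorphism and $\operatorname{Ext}^i_R(C,M)=0=\operatorname{Tor}^R_i(C,\operatorname{Hom}_R(C,M))$ for all $i\ge1$. Assume that $R$ is $\mathfrak a$-relative regular (as a module over itself). Then for every semidualizing $R$-module $C$, the functors $C\otimes_R-$ and $\operatorname{Hom}_R(C,-)$ restrict to mutually quasi-inverse equivalences of categories between the full subcategories $\mathscr A_C(R)\cap\mathscr R_{\mathfrak a}(R)$ and $\mathscr B_C(R)\cap\mathscr R_{\mathfrak a}(R)$ of the category of $R$-modules. -/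

import Mathlib

open CategoryTheory MonoidalCategory

universe u

noncomputable section

namespace RelativeRegular

variable {R : Type u} [CommRing R]

/-- The cohomological dimension `cd(𝔞, M)`: the largest `i` such that the local cohomology module
`H_𝔞^i(M)` is nonzero (`⊥` if there is no such `i`, `⊤` if there are arbitrarily large ones). -/
def cohomologicalDimension (𝔞 : Ideal R) (M : ModuleCat.{u} R) : WithBot ℕ∞ :=
  ⨆ (i : ℕ) (_ : ¬ Limits.IsZero ((localCohomology 𝔞 i).obj M)), ((i : ℕ∞) : WithBot ℕ∞)

/-- `M` is `𝔞`-relative regular: `M` is finitely generated and either `M = 𝔞 M`, or `M ≠ 𝔞 M` and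
`𝔞` is generated by an `M`-regular sequence of length `cd(𝔞, R)` that is also `R`-regular. -/
def IsRelativeRegular (𝔞 : Ideal R) : ObjectProperty (ModuleCat.{u} R) := fun M =>
  Module.Finite R M ∧
    ((⊤ : Submodule R M) = 𝔞 • (⊤ : Submodule R M) ∨
      ((⊤ : Submodule R M) ≠ 𝔞 • (⊤ : Submodule R M) ∧
        ∃ xs : List R, Ideal.ofList xs = 𝔞 ∧
          RingTheory.Sequence.IsRegular M xs ∧
          RingTheory.Sequence.IsRegular R xs ∧
          ((xs.length : ℕ∞) : WithBot ℕ∞) = cohomologicalDimension 𝔞 (ModuleCat.of R R)))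

/-- A finitely generated module `C` is semidualizing if the homothety map `R → Hom(C, C)` is an
isomorphism and `Ext^i(C, C) = 0` for all `i > 0`. -/
structure IsSemidualizing (C : ModuleCat.{u} R) : Prop where
  finite : Module.Finite R C
  homothety_bijective : Function.Bijective (LinearMap.lsmul R C : R →ₗ[R] C →ₗ[R] C)
  subsingleton_ext : ∀ i : ℕ, 0 < i → Subsingleton (Abelian.Ext.{u} C C i)

/-- The functor `C ⊗ -` on `R`-modules. -/
abbrev tensorFunctor (C : ModuleCat.{u} R) : ModuleCat.{u} R ⥤ ModuleCat.{u} R :=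
  tensorLeft C

/-- The functor `Hom(C, -)` on `R`-modules. -/
abbrev homFunctor (C : ModuleCat.{u} R) : ModuleCat.{u} R ⥤ ModuleCat.{u} R :=
  ihom C

/-- The natural map `M → Hom(C, C ⊗ M)`. -/
abbrev gamma (C M : ModuleCat.{u} R) : M ⟶ (homFunctor C).obj ((tensorFunctor C).obj M) :=
  (ihom.coev C).app M

/-- The evaluation map `C ⊗ Hom(C, M) → M`. -/
abbrev xi (C M : ModuleCat.{u} R) : (tensorFunctor C).obj ((homFunctor C).obj M) ⟶ M :=
  (ihom.ev C).app M

theorem homFunctor_obj (C M : ModuleCat.{u} R) :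
    (homFunctor C).obj M = ModuleCat.of R (C ⟶ M) := rfl

theorem homFunctor_map_apply {C M N : ModuleCat.{u} R} (f : M ⟶ N) (g : C ⟶ M) :
    (homFunctor C).map f g = g ≫ f := rfl

theorem gamma_apply (C M : ModuleCat.{u} R) (m : M) (c : C) :
    ((gamma C M).hom m).hom c = TensorProduct.tmul R c m := rfl

theorem xi_apply (C M : ModuleCat.{u} R) (c : C) (f : C ⟶ M) :
    (xi C M).hom (TensorProduct.tmul R c f) = f.hom c := by
  unfold xi
  rw [ModuleCat.ihom_ev_app]
  rfl

/-- The Auslander class of `C`: the `R`-modules `M` such that `M → Hom(C, C ⊗ M)` is an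
isomorphism and `Tor_i(C, M) = 0 = Ext^i(C, C ⊗ M)` for all `i ≥ 1`. -/
def auslanderClass (C : ModuleCat.{u} R) : ObjectProperty (ModuleCat.{u} R) := fun M =>
  IsIso (gamma C M) ∧
    ∀ i : ℕ, 1 ≤ i →
      Limits.IsZero (((Tor (ModuleCat.{u} R) i).obj C).obj M) ∧
      Subsingleton (Abelian.Ext.{u} C ((tensorFunctor C).obj M) i)

/-- The Bass class of `C`: the `R`-modules `M` such that `C ⊗ Hom(C, M) → M` is an isomorphism and
`Ext^i(C, M) = 0 = Tor_i(C, Hom(C, M))` for all `i ≥ 1`. -/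
def bassClass (C : ModuleCat.{u} R) : ObjectProperty (ModuleCat.{u} R) := fun M =>
  IsIso (xi C M) ∧
    ∀ i : ℕ, 1 ≤ i →
      Subsingleton (Abelian.Ext.{u} C M i) ∧
      Limits.IsZero (((Tor (ModuleCat.{u} R) i).obj C).obj ((homFunctor C).obj M))

end RelativeRegular

end

namespace RelativeRegular

open RingTheory.Sequence Abelian Pointwise

variable {R : Type u} [CommRing R]

/-! The adjunction between `C ⊗ -` and `Hom(C, -)` already restricts to an equivalence of the
Auslander and Bass classes, so only relative regularity has to be transported. Its conditions on `R`
and on the length do not involve the module; it suffices that `Hom(C, Y)` and `Y`, for `Y` in the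
Bass class, have the same weakly regular sequences (`isWeaklyRegular_linearMap_iff`) and satisfy `M
= 𝔞 M` simultaneously. The former is an induction: `C` is faithful, and vanishing of `Ext` lets
`Hom(C, -)` commute with `Y ↦ Y / rY`. The latter depends only on the annihilator, and the two
annihilators agree because `Y ≅ C ⊗ Hom(C, Y)`. -/

/-- The smul-regular elements of `Hom(C, Y)` and of `Y` agree when `C` is finite and faithful. -/
theorem isSMulRegular_linearMap_iff [IsNoetherianRing R] {C Y : Type u} [AddCommGroup C]
    [Module R C] [Module.Finite R C] [AddCommGroup Y] [Module R Y] [Module.Finite R Y]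
    (hC : Module.annihilator R C = ⊥) (r : R) :
    IsSMulRegular (C →ₗ[R] Y) r ↔ IsSMulRegular Y r := by
  refine ⟨fun h ↦ ?_, fun h f g hfg ↦ LinearMap.ext fun c ↦ h (LinearMap.congr_fun hfg c)⟩
  have hsub : Subsingleton (C →ₗ[R] LinearMap.ker (LinearMap.lsmul R Y r)) := by
    refine ⟨fun f g ↦ ?_⟩
    have key : ∀ f : C →ₗ[R] LinearMap.ker (LinearMap.lsmul R Y r),
        (Submodule.subtype _).comp f = 0 := by
      intro f
      refine h (LinearMap.ext fun c ↦ ?_)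
      exact (LinearMap.mem_ker.mp (f c).2).trans (smul_zero r).symm
    exact LinearMap.ext fun c ↦ Subtype.ext
      (LinearMap.congr_fun ((key f).trans (key g).symm) c)
  -- Since `Hom(C, ker r) = 0`, some element of `Ann C = 0` is regular on `ker r`; regularity of
  -- zero forces `ker r = 0`.
  obtain ⟨s, hs, hreg⟩ := IsSMulRegular.subsingleton_linearMap_iff.mp hsub
  obtain rfl : s = 0 := by simpa [hC] using hs
  have := IsSMulRegular.zero_iff_subsingleton.mp hreg
  intro y z hyz
  have hmem : y - z ∈ LinearMap.ker (LinearMap.lsmul R Y r) := by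
    simpa [smul_sub, sub_eq_zero] using hyz
  exact sub_eq_zero.mp (congrArg Subtype.val
    (Subsingleton.elim (⟨y - z, hmem⟩ : LinearMap.ker (LinearMap.lsmul R Y r)) 0))

/-- Every map `C → Y / rY` lifts to `Y` when `r` is `Y`-regular and `Ext¹(C, Y) = 0`. -/
theorem exists_mkQ_comp_eq {C Y : ModuleCat.{u} R} {r : R} (hr : IsSMulRegular Y r)
    (hext : Subsingleton (Ext.{u} C Y 1)) (f : C →ₗ[R] QuotSMulTop r Y) :
    ∃ g : C →ₗ[R] Y, (Submodule.mkQ _).comp g = f := by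
  have hS := hr.smulShortComplex_shortExact
  let f' : C ⟶ (Y.smulShortComplex r).X₃ := ModuleCat.ofHom f
  -- The obstruction to lifting `f` is its image in `Ext¹(C, Y) = 0`.
  obtain ⟨x, hx⟩ := Ext.covariant_sequence_exact₃ C hS (Ext.mk₀ f') (n₁ := 1) rfl
    (@Subsingleton.elim _ hext _ _)
  obtain ⟨g, rfl⟩ := Ext.homEquiv₀.symm.surjective x
  refine ⟨g.hom, ?_⟩
  have hgf : g ≫ (Y.smulShortComplex r).g = f' := by
    apply Ext.homEquiv₀.symm.injective
    simpa using hx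
  exact congrArg ModuleCat.Hom.hom hgf

/-- `Hom(C, Y) / r Hom(C, Y) ≃ Hom(C, Y / rY)` when `r` is `Y`-regular and `Ext¹(C, Y) = 0`. -/
theorem nonempty_quotSMulTop_linearMap_equiv {C Y : ModuleCat.{u} R} {r : R}
    (hr : IsSMulRegular Y r) (hext : Subsingleton (Ext.{u} C Y 1)) :
    Nonempty (QuotSMulTop r (C →ₗ[R] Y) ≃ₗ[R] (C →ₗ[R] QuotSMulTop r Y)) := by
  let φ : (C →ₗ[R] Y) →ₗ[R] (C →ₗ[R] QuotSMulTop r Y) :=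
    LinearMap.llcomp R C Y _ (Submodule.mkQ (r • (⊤ : Submodule R Y)))
  have hφ : Function.Surjective φ := exists_mkQ_comp_eq hr hext
  have hker : r • (⊤ : Submodule R (C →ₗ[R] Y)) = LinearMap.ker φ := by
    ext f
    rw [Submodule.mem_smul_pointwise_iff_exists]
    constructor
    · rintro ⟨g, -, rfl⟩
      refine LinearMap.ext fun c ↦ (Submodule.Quotient.mk_eq_zero _).mpr ?_
      exact Submodule.smul_mem_pointwise_smul _ _ _ trivial
    · intro hf
      have hmem : ∀ c, f c ∈ LinearMap.range (LinearMap.lsmul R Y r) := fun c ↦ by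
        obtain ⟨y, -, hy⟩ := (Submodule.mem_smul_pointwise_iff_exists _ _ _).mp
          ((Submodule.Quotient.mk_eq_zero _).mp (LinearMap.congr_fun hf c))
        exact ⟨y, hy⟩
      -- Multiplication by `r` identifies `Y` with `rY`, so a map with values in `rY` can be divided
      -- by `r`.
      let e := LinearEquiv.ofInjective (LinearMap.lsmul R Y r) hr
      refine ⟨e.symm.toLinearMap.comp (f.codRestrict _ hmem), trivial, LinearMap.ext fun c ↦ ?_⟩
      exact congrArg Subtype.val (e.apply_symm_apply (f.codRestrict _ hmem c))
  exact ⟨(Submodule.quotEquivOfEq _ _ hker).trans (φ.quotKerEquivOfSurjective hφ)⟩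

/-- The long exact sequence places `Ext^i(C, Y / rY)` between `Ext^i(C, Y)` and `Ext^(i+1)(C, Y)`.
-/
theorem subsingleton_ext_quotSMulTop {C Y : ModuleCat.{u} R} {r : R} (hr : IsSMulRegular Y r)
    (hext : ∀ i : ℕ, 1 ≤ i → Subsingleton (Ext.{u} C Y i)) (i : ℕ) (hi : 1 ≤ i) :
    Subsingleton (Ext.{u} C (ModuleCat.of R (QuotSMulTop r Y)) i) := by
  have h₁ := AddCommGrpCat.isZero_of_iff_subsingleton.mpr (hext i hi)
  have h₂ := AddCommGrpCat.isZero_of_iff_subsingleton.mpr (hext (i + 1) (by omega))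
  exact AddCommGrpCat.subsingleton_of_isZero <| ShortComplex.Exact.isZero_of_both_zeros
    (Ext.covariant_sequence_exact₃' C hr.smulShortComplex_shortExact i (i + 1) rfl)
    (h₁.eq_zero_of_src _) (h₂.eq_zero_of_tgt _)

/-- For `C` finite and faithful with `Ext^i(C, Y) = 0` for `i ≥ 1`, the modules `Hom(C, Y)` and `Y`
have the same weakly regular sequences. -/
theorem isWeaklyRegular_linearMap_iff [IsNoetherianRing R] {C : ModuleCat.{u} R}
    [Module.Finite R C] (hC : Module.annihilator R C = ⊥) (rs : List R) (Y : ModuleCat.{u} R)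
    [Module.Finite R Y] (hext : ∀ i : ℕ, 1 ≤ i → Subsingleton (Ext.{u} C Y i)) :
    IsWeaklyRegular (C →ₗ[R] Y) rs ↔ IsWeaklyRegular Y rs := by
  induction rs generalizing Y with
  | nil => simp
  | cons r rs ih =>
    rw [isWeaklyRegular_cons_iff, isWeaklyRegular_cons_iff, isSMulRegular_linearMap_iff hC]
    refine and_congr_right fun hr ↦ ?_
    obtain ⟨e⟩ := nonempty_quotSMulTop_linearMap_equiv hr (hext 1 le_rfl)
    rw [e.isWeaklyRegular_congr]
    exact ih (ModuleCat.of R (QuotSMulTop r Y)) (subsingleton_ext_quotSMulTop hr hext)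

theorem IsSemidualizing.annihilator_eq_bot {C : ModuleCat.{u} R} (hC : IsSemidualizing C) :
    Module.annihilator R C = ⊥ := by
  refine (Submodule.eq_bot_iff _).mpr fun r hr ↦ hC.homothety_bijective.1 ?_
  exact LinearMap.ext fun c ↦ (Module.mem_annihilator.mp hr c).trans (zero_smul R c).symm

/-- A finite module `M` satisfies `M = 𝔞 M` iff `𝔞` and the annihilator of `M` are comaximal. -/
theorem top_eq_smul_top_iff (𝔞 : Ideal R) (M : Type u) [AddCommGroup M] [Module R M]
    [Module.Finite R M] :
    (⊤ : Submodule R M) = 𝔞 • (⊤ : Submodule R M) ↔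
      ∃ r : R, r - 1 ∈ 𝔞 ∧ r ∈ Module.annihilator R M := by
  constructor
  · intro h
    -- Nakayama's lemma in its determinant-trick form.
    obtain ⟨r, hr, hr'⟩ := Submodule.exists_sub_one_mem_and_smul_eq_zero_of_fg_of_le_smul 𝔞 _
      (Module.Finite.fg_top (R := R) (M := M)) h.le
    exact ⟨r, hr, Module.mem_annihilator.mpr fun m ↦ hr' m trivial⟩
  · rintro ⟨r, hr, hr'⟩
    refine le_antisymm (fun m _ ↦ ?_) le_top
    have : m = -((r - 1) • m) := by
      rw [sub_smul, Module.mem_annihilator.mp hr' m]; simp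
    rw [this]
    exact neg_mem (Submodule.smul_mem_smul hr trivial)

theorem annihilator_le_annihilator_tensorProduct (C M : Type u) [AddCommGroup C] [Module R C]
    [AddCommGroup M] [Module R M] :
    Module.annihilator R M ≤ Module.annihilator R (TensorProduct R C M) := by
  intro r hr
  refine Module.mem_annihilator.mpr fun t ↦ ?_
  induction t with
  | zero => simp
  | tmul c m => rw [← TensorProduct.tmul_smul, Module.mem_annihilator.mp hr, TensorProduct.tmul_zero]
  | add x y hx hy => rw [smul_add, hx, hy, add_zero]

theorem annihilator_le_annihilator_linearMap (C M : Type u) [AddCommGroup C] [Module R C]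
    [AddCommGroup M] [Module R M] :
    Module.annihilator R M ≤ Module.annihilator R (C →ₗ[R] M) := by
  intro r hr
  exact Module.mem_annihilator.mpr fun f ↦ LinearMap.ext fun c ↦ Module.mem_annihilator.mp hr (f c)

theorem isRegular_of_isWeaklyRegular {𝔞 : Ideal R} {xs : List R} (hxs : Ideal.ofList xs = 𝔞)
    {M : Type u} [AddCommGroup M] [Module R M] (h : IsWeaklyRegular M xs)
    (hM : (⊤ : Submodule R M) ≠ 𝔞 • (⊤ : Submodule R M)) : IsRegular M xs :=
  ⟨h, by rwa [hxs]⟩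

/-- Relative regularity passes between finite modules with the same weakly regular sequences on
which `𝔞` acts surjectively at the same time. -/
theorem IsRelativeRegular.of_iff {𝔞 : Ideal R} {M N : ModuleCat.{u} R}
    (hN : Module.Finite R N)
    (htop : (⊤ : Submodule R M) = 𝔞 • (⊤ : Submodule R M) ↔
      (⊤ : Submodule R N) = 𝔞 • (⊤ : Submodule R N))
    (hreg : ∀ xs : List R, IsWeaklyRegular M xs → IsWeaklyRegular N xs)
    (hM : IsRelativeRegular 𝔞 M) : IsRelativeRegular 𝔞 N := by
  refine ⟨hN, hM.2.imp htop.mp ?_⟩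
  rintro ⟨hne, xs, hxs, hxM, hxR, hlen⟩
  have hne' := fun h ↦ hne (htop.mpr h)
  exact ⟨hne', xs, hxs, isRegular_of_isWeaklyRegular hxs (hreg xs hxM.1) hne', hxR, hlen⟩

theorem finite_linearMap [IsNoetherianRing R] (C Y : ModuleCat.{u} R) [Module.Finite R C]
    [Module.Finite R Y] : Module.Finite R ((homFunctor C).obj Y) :=
  Module.Finite.equiv (ModuleCat.homLinearEquiv (S := R) (M := C) (N := Y)).symm

/-- If `C ⊗ Hom(C, Y) ≅ Y` and `Ext^i(C, Y) = 0` for `i ≥ 1`, then `Hom(C, Y)` is relative regular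
iff `Y` is. -/
theorem IsSemidualizing.isRelativeRegular_hom_iff [IsNoetherianRing R] {𝔞 : Ideal R}
    {C : ModuleCat.{u} R} (hC : IsSemidualizing C) (Y : ModuleCat.{u} R) [IsIso (xi C Y)]
    (hext : ∀ i : ℕ, 1 ≤ i → Subsingleton (Ext.{u} C Y i)) :
    IsRelativeRegular 𝔞 ((homFunctor C).obj Y) ↔ IsRelativeRegular 𝔞 Y := by
  have := hC.finite
  let e : (homFunctor C).obj Y ≃ₗ[R] (C →ₗ[R] Y) := ModuleCat.homLinearEquiv (S := R)
  let e' : TensorProduct R C ((homFunctor C).obj Y) ≃ₗ[R] Y := (asIso (xi C Y)).toLinearEquiv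
  have hfin : Module.Finite R ((homFunctor C).obj Y) → Module.Finite R Y := fun _ ↦
    Module.Finite.equiv e'
  have htop [Module.Finite R Y] :
      (⊤ : Submodule R ((homFunctor C).obj Y)) =
          𝔞 • (⊤ : Submodule R ((homFunctor C).obj Y)) ↔
        (⊤ : Submodule R Y) = 𝔞 • (⊤ : Submodule R Y) := by
    have := finite_linearMap C Y
    have hann : Module.annihilator R ((homFunctor C).obj Y) = Module.annihilator R Y := by
      apply le_antisymm
      · rw [← e'.annihilator_eq]
        exact annihilator_le_annihilator_tensorProduct C _
      · rw [e.annihilator_eq]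
        exact annihilator_le_annihilator_linearMap C _
    rw [top_eq_smul_top_iff, top_eq_smul_top_iff, hann]
  have hreg [Module.Finite R Y] (xs : List R) :
      IsWeaklyRegular ((homFunctor C).obj Y) xs ↔ IsWeaklyRegular Y xs := by
    rw [e.isWeaklyRegular_congr, isWeaklyRegular_linearMap_iff hC.annihilator_eq_bot xs Y hext]
  constructor
  · intro h
    have := hfin h.1
    exact h.of_iff this htop fun xs ↦ (hreg xs).mp
  · intro h
    have := h.1
    exact h.of_iff (finite_linearMap C Y) htop.symm fun xs ↦ (hreg xs).mpr

theorem IsRelativeRegular.of_iso {𝔞 : Ideal R} {M N : ModuleCat.{u} R} (e : M ≅ N)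
    (h : IsRelativeRegular 𝔞 M) : IsRelativeRegular 𝔞 N := by
  have := h.1
  have hN : Module.Finite R N := Module.Finite.equiv e.toLinearEquiv
  refine h.of_iff hN ?_ fun xs ↦ (e.toLinearEquiv.isWeaklyRegular_congr xs).mp
  rw [top_eq_smul_top_iff, top_eq_smul_top_iff, e.toLinearEquiv.annihilator_eq]

/-- By the triangle identity, `ξ` is a left inverse of the isomorphism `C ⊗ γ`. -/
theorem isIso_xi_tensor (C M : ModuleCat.{u} R) [IsIso (gamma C M)] :
    IsIso (xi C ((tensorFunctor C).obj M)) := by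
  have h : (tensorFunctor C).map (gamma C M) ≫ xi C ((tensorFunctor C).obj M) = 𝟙 _ :=
    (ihom.adjunction C).left_triangle_components M
  exact IsIso.of_isIso_fac_left h

theorem isIso_gamma_hom (C N : ModuleCat.{u} R) [IsIso (xi C N)] :
    IsIso (gamma C ((homFunctor C).obj N)) := by
  have h : gamma C ((homFunctor C).obj N) ≫ (homFunctor C).map (xi C N) = 𝟙 _ :=
    (ihom.adjunction C).right_triangle_components N
  exact IsIso.of_isIso_fac_right h

theorem bassClass_tensor {C M : ModuleCat.{u} R} (hM : auslanderClass C M) :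
    bassClass C ((tensorFunctor C).obj M) := by
  have := hM.1
  refine ⟨isIso_xi_tensor C M, fun i hi ↦ ⟨(hM.2 i hi).2, ?_⟩⟩
  exact (hM.2 i hi).1.of_iso (((Tor (ModuleCat.{u} R) i).obj C).mapIso (asIso (gamma C M))).symm

theorem auslanderClass_hom {C N : ModuleCat.{u} R} (hN : bassClass C N) :
    auslanderClass C ((homFunctor C).obj N) := by
  have := hN.1
  refine ⟨isIso_gamma_hom C N, fun i hi ↦ ⟨(hN.2 i hi).2, ?_⟩⟩
  have : Subsingleton ((extFunctorObj C i).obj N) := (hN.2 i hi).1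
  exact (((extFunctorObj C i).mapIso (asIso (xi C N))).addCommGroupIsoToAddEquiv).subsingleton

/-- The adjunction between `C ⊗ -` and `Hom(C, -)` restricts to an equivalence between full
subcategories that the two functors exchange and on which unit and counit are isomorphisms. -/
noncomputable def equivalenceOfIsIso (C : ModuleCat.{u} R) (P Q : ObjectProperty (ModuleCat.{u} R))
    (hF : ∀ M : P.FullSubcategory, Q ((tensorFunctor C).obj M.obj))
    (hG : ∀ N : Q.FullSubcategory, P ((homFunctor C).obj N.obj))
    (hP : ∀ M : P.FullSubcategory, IsIso (gamma C M.obj))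
    (hQ : ∀ N : Q.FullSubcategory, IsIso (xi C N.obj)) :
    P.FullSubcategory ≌ Q.FullSubcategory :=
  CategoryTheory.Equivalence.mk (Q.lift (P.ι ⋙ tensorFunctor C) hF)
    (P.lift (Q.ι ⋙ homFunctor C) hG)
    (NatIso.ofComponents (fun M ↦ have := hP M; P.isoMk (asIso (gamma C M.obj))) fun f ↦
      ObjectProperty.hom_ext _ ((ihom.coev C).naturality f.hom))
    (NatIso.ofComponents (fun N ↦ have := hQ N; Q.isoMk (asIso (xi C N.obj))) fun f ↦
      ObjectProperty.hom_ext _ ((ihom.ev C).naturality f.hom))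

end RelativeRegular

theorem proposition4 {R : Type u} [CommRing R] [IsNoetherianRing R] (𝔞 : Ideal R) (h𝔞 : 𝔞 ≠ ⊤)
    (hR : RelativeRegular.IsRelativeRegular 𝔞 (ModuleCat.of R R))
    (C : ModuleCat.{u} R) (hC : RelativeRegular.IsSemidualizing C) :
    ∃ (hF : ∀ M : (RelativeRegular.auslanderClass C ⊓
          RelativeRegular.IsRelativeRegular 𝔞).FullSubcategory,
        (RelativeRegular.bassClass C ⊓ RelativeRegular.IsRelativeRegular 𝔞)
          ((RelativeRegular.tensorFunctor C).obj M.obj))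
      (hG : ∀ N : (RelativeRegular.bassClass C ⊓
          RelativeRegular.IsRelativeRegular 𝔞).FullSubcategory,
        (RelativeRegular.auslanderClass C ⊓ RelativeRegular.IsRelativeRegular 𝔞)
          ((RelativeRegular.homFunctor C).obj N.obj))
      (e : (RelativeRegular.auslanderClass C ⊓
            RelativeRegular.IsRelativeRegular 𝔞).FullSubcategory ≌
          (RelativeRegular.bassClass C ⊓ RelativeRegular.IsRelativeRegular 𝔞).FullSubcategory),
      e.functor = ObjectProperty.lift _
          (ObjectProperty.ι _ ⋙ RelativeRegular.tensorFunctor C) hF ∧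
        e.inverse = ObjectProperty.lift _
          (ObjectProperty.ι _ ⋙ RelativeRegular.homFunctor C) hG := by
  have hF : ∀ M : (RelativeRegular.auslanderClass C ⊓
        RelativeRegular.IsRelativeRegular 𝔞).FullSubcategory,
      (RelativeRegular.bassClass C ⊓ RelativeRegular.IsRelativeRegular 𝔞)
        ((RelativeRegular.tensorFunctor C).obj M.obj) := by
    rintro ⟨M, hA, hM⟩
    have := hA.1
    have hB := RelativeRegular.bassClass_tensor hA
    have := hB.1
    -- Take `Y = C ⊗ M`; then `γ` identifies `M` with `Hom(C, Y)`.
    exact ⟨hB, (hC.isRelativeRegular_hom_iff _ fun i hi ↦ (hB.2 i hi).1).mp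
      (hM.of_iso (asIso (RelativeRegular.gamma C M)))⟩
  have hG : ∀ N : (RelativeRegular.bassClass C ⊓
        RelativeRegular.IsRelativeRegular 𝔞).FullSubcategory,
      (RelativeRegular.auslanderClass C ⊓ RelativeRegular.IsRelativeRegular 𝔞)
        ((RelativeRegular.homFunctor C).obj N.obj) := by
    rintro ⟨N, hB, hN⟩
    have := hB.1
    exact ⟨RelativeRegular.auslanderClass_hom hB,
      (hC.isRelativeRegular_hom_iff _ fun i hi ↦ (hB.2 i hi).1).mpr hN⟩
  -- `Equivalence.mk` may alter the unit but keeps both functors, hence `rfl`.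
  exact ⟨hF, hG, RelativeRegular.equivalenceOfIsIso C _ _ hF hG (fun M ↦ M.property.1.1)
    (fun N ↦ N.property.1.1), rfl, rfl⟩
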